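/- **Setting.** Fix integers $d\ge n\ge 0$ and $m\ge 0$. A *model* $(g,f,p_Z,\Theta)$ with $n$ latent variables, $d$ observed variables and $m$ domains $\Theta=\{\theta^{(1)},\dots,\theta^{(m)}\}$ consists of: a latent structural equation model $Z_i=f_i(\mathrm{PA}(Z_i),\epsilon_i;\theta_i)$, $i=1,\dots,n$, with acyclic parent relation, measurable mechanisms $f_i$, mutually independent exogenous noises $\epsilon_i$ and latent factors $\theta=(\theta_1,\dots,\theta_n)$ that may change with the domain, such that in every domain $\theta\in\Theta$ the vector $Z=(Z_1,\dots,Z_n)$ has a Lebesgue density $p_Z(\cdot;\theta)$ on $\mathbb{R}^n$; and a mixing map $g:\mathbb{R}^n\to\mathbb{R}^d$ that is a $C^2$-diffeomorphism onto its image. The observed vector is $X=g(Z)$, with distribution $P_{X;\theta}$ in domain $\theta$. The *Markov network* $\mathcal M_Z$ of a model is the undirected graph on $\{1,\dots,n\}$ in which distinct $i,j$ are nonadjacent if and only if, in every domain, $Z_i$ and $Z_j$ are conditionally independent given $(Z_k)_{k\ne i,j}$. Let $\mathcal E(\mathcal M_Z)$ be its edge set and $|\mathcal M_Z|$ its number of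 edges. **Theorem (Identifiability of the latent Markov network).** Let $(g,f,p_Z,\Theta)$ be a model (the true model) such that: * (A1) for every $\theta\in\Theta$ the density $p_Z(\cdot;\theta)$ is twice continuously differentiable and positive on $\mathbb{R}^n$; * (A2) for every $z\in\mathbb{R}^n$ there are $2n+|\mathcal M_Z|+1$ domains in $\Theta$, denoted $\theta^{(u)}$ with $u=0,\dots,2n+|\mathcal M_Z|$ (they may depend on $z$), such that the vectors $w(z,u)-w(z,0)$, $u=1,\dots,2n+|\mathcal M_Z|$, are linearly independent, where $$w(z,u)=\Big(\tfrac{\partial\log p_Z(z;\theta^{(u)})}{\partial z_i}\Big)_{i}\oplus\Big(\tfrac{\partial^2\log p_Z(z;\theta^{(u)})}{\partial z_i^2}\Big)_{i}\oplus\Big(\tfrac{\partial^2\log p_Z(z;\theta^{(u)})}{\partial z_i\partial z_j}\Big)_{\{i,j\}\in\mathcal E(\mathcal M_Z),\ i<j}.$$ Let $(\hat g,\hat f,p_{\hat Z},\hat\Theta)$ be a model with the same $n,d,m$ that matches the observed distributions, $P_{\hat X;\hat\theta^{(u)}}=P_{X;\theta^{(u)}}$ for every domain $u=1,\dots,m$,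 and whose Markov network $\mathcal M_{\hat Z}$ has the minimal number of edges among all models that match the observed distributions in this way. Then $\mathcal M_{\hat Z}$ is isomorphic to $\mathcal M_Z$: there is a permutation $\pi$ of $\{1,\dots,n\}$ such that, for all $i,j$, $\{i,j\}$ is an edge of $\mathcal M_Z$ if and only if $\{\pi(i),\pi(j)\}$ is an edge of $\mathcal M_{\hat Z}$. -/

import Mathlib

open MeasureTheory ProbabilityTheory

noncomputable section

/-- A structural equation model over `n` real latent variables, observed in `m` domains:
`Z_i = f_i (PA(Z_i), ε_i; θ_i)`, with an acyclic parent relation and mutually independent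
exogenous noises `ε_i`. The noise space is the product `∏ i, Noise i` with the product law, so that
the coordinates are mutually independent. The latent factor `θ u = (θ_1, …, θ_n)` is the only thing
that varies with the domain `u`. -/
structure LatentSEM (n m : ℕ) where
  /-- `parents i` is the set of parents of variable `i`. -/
  parents : Fin n → Finset (Fin n)
  /-- There is no directed cycle. -/
  acyclic : ∀ i, ¬ Relation.TransGen (fun j k => j ∈ parents k) i i
  /-- The space of values of the `i`-th noise variable. -/
  Noise : Fin n → Type
  noiseSpace : ∀ i, MeasurableSpace (Noise i)
  noiseLaw : ∀ i, Measure (Noise i)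
  noiseLaw_prob : ∀ i, IsProbabilityMeasure (noiseLaw i)
  /-- The space of values of the latent factor `θ_i`. -/
  Factor : Fin n → Type
  /-- The value of the latent factors in each domain. -/
  θ : Fin m → ∀ i, Factor i
  /-- The causal mechanisms. -/
  f : ∀ i, (parents i → ℝ) → Noise i → Factor i → ℝ
  f_measurable : ∀ i t, Measurable (fun q : (parents i → ℝ) × Noise i => f i q.1 q.2 t)
  /-- The latent variables in domain `u`, as functions of the noise. By acyclicity they are
  uniquely determined by the structural equations `Z_eq`. -/
  Z : Fin m → (∀ i, Noise i) → (Fin n → ℝ)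
  Z_measurable : ∀ u, Measurable (Z u)
  /-- The structural equations. -/
  Z_eq : ∀ u e i, Z u e i = f i (fun j => Z u e j) (e i) (θ u i)

namespace LatentSEM

variable {n m : ℕ} (S : LatentSEM n m)

instance (i : Fin n) : MeasurableSpace (S.Noise i) := S.noiseSpace i

instance (i : Fin n) : IsProbabilityMeasure (S.noiseLaw i) := S.noiseLaw_prob i

/-- The law `P_{Z;θ}` of the latent variables in domain `u`. -/
def latentLaw (u : Fin m) : Measure (Fin n → ℝ) :=
  (Measure.pi S.noiseLaw).map (S.Z u)

instance (u : Fin m) : IsProbabilityMeasure (S.latentLaw u) :=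
  Measure.isProbabilityMeasure_map (S.Z_measurable u).aemeasurable

end LatentSEM

/-- `g : ℝⁿ → ℝᵈ` is a `C²`-diffeomorphism onto its image. -/
def IsC2DiffeoOntoImage {n d : ℕ} (g : (Fin n → ℝ) → (Fin d → ℝ)) : Prop :=
  ContDiff ℝ 2 g ∧
    ∃ h : (Fin d → ℝ) → (Fin n → ℝ), Function.LeftInverse h g ∧ ContDiffOn ℝ 2 h (Set.range g)

/-- A model `(g, f, p_Z, Θ)`: latent variables following a structural equation model, with a
Lebesgue density in every domain, and observed through a mixing function `g` that is a
`C²`-diffeomorphism onto its image. -/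
structure CausalModel (n d m : ℕ) extends LatentSEM n m where
  /-- The probability density `p_Z(·; θ^{(u)})` of the latent variables in domain `u`. -/
  density : Fin m → (Fin n → ℝ) → ℝ
  density_measurable : ∀ u, Measurable (density u)
  density_nonneg : ∀ u z, 0 ≤ density u z
  latentLaw_eq : ∀ u,
    toLatentSEM.latentLaw u = volume.withDensity (fun z => ENNReal.ofReal (density u z))
  /-- The mixing function. -/
  g : (Fin n → ℝ) → (Fin d → ℝ)
  g_diffeo : IsC2DiffeoOntoImage g

/-- Under the law `μ` on `ℝⁿ`, the coordinates `i` and `j` are conditionally independent given the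
coordinates in `s`. -/
def CoordCondIndep {n : ℕ} (μ : Measure (Fin n → ℝ)) [IsFiniteMeasure μ] (i j : Fin n)
    (s : Set (Fin n)) : Prop :=
  CondIndepFun (MeasurableSpace.comap (fun (z : Fin n → ℝ) (k : s) => z k) inferInstance)
    (Measurable.comap_le (measurable_pi_lambda _ fun k => measurable_pi_apply k.1))
    (fun z : Fin n → ℝ => z i) (fun z : Fin n → ℝ => z j) μ

theorem CoordCondIndep.symm {n : ℕ} {μ : Measure (Fin n → ℝ)} [IsFiniteMeasure μ] {i j : Fin n}
    {s : Set (Fin n)} (h : CoordCondIndep μ i j s) : CoordCondIndep μ j i s :=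
  CondIndepFun.symm h

namespace CausalModel

variable {n d m : ℕ} (M : CausalModel n d m)

/-- The Markov network over the latent variables: `i` and `j` are adjacent if and only if they are
conditionally dependent given all the other latent variables (that is, nonadjacent means that the
conditional independence holds in every domain). -/
def markovNetwork : SimpleGraph (Fin n) where
  Adj i j := i ≠ j ∧ ¬ ∀ u, CoordCondIndep (M.latentLaw u) i j {i, j}ᶜ
  symm := ⟨fun i j h => ⟨h.1.symm, fun H => h.2 fun u => by
    rw [Set.pair_comm]; exact (H u).symm⟩⟩
  loopless := ⟨fun _ h => h.1 rfl⟩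

/-- `|M_Z|`, the number of edges of the Markov network. -/
def numEdges : ℕ := M.markovNetwork.edgeSet.ncard

/-- The law `P_{X;θ}` of the observed variables `X = g(Z)` in domain `u`. -/
def observedLaw (u : Fin m) : Measure (Fin d → ℝ) := (M.latentLaw u).map M.g

/-- The two models have the same distribution of the observed variables in every domain. -/
def Matches (M' : CausalModel n d m) : Prop := ∀ u, M'.observedLaw u = M.observedLaw u

/-- `M'` matches the observed distributions of `M`, with the least number of Markov network edges
among all the models that do so. -/
def IsEdgeMinimalMatch (M' : CausalModel n d m) : Prop :=
  M.Matches M' ∧ ∀ M'' : CausalModel n d m, M.Matches M'' → M'.numEdges ≤ M''.numEdges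

/-- Smooth and positive density. -/
def SmoothPositiveDensity : Prop :=
  ∀ u, ContDiff ℝ 2 (M.density u) ∧ ∀ z, 0 < M.density u z

/-- `∂φ/∂z_i`. -/
def partialDeriv (i : Fin n) (φ : (Fin n → ℝ) → ℝ) (z : Fin n → ℝ) : ℝ :=
  fderiv ℝ φ z (Pi.single i 1)

/-- `log p(z; θ^{(u)})`. -/
def logDensity (u : Fin m) (z : Fin n → ℝ) : ℝ := Real.log (M.density u z)

/-- The edges `{i, j}` of the Markov network, represented by the pairs `i < j`. -/
abbrev OrderedEdge : Type := {e : Fin n × Fin n // e.1 < e.2 ∧ M.markovNetwork.Adj e.1 e.2}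

/-- The vector `w(z, u)` made of the first derivatives, the pure second derivatives, and the mixed
second derivatives along the edges of the Markov network, of `log p(z; θ^{(u)})`. -/
def w (z : Fin n → ℝ) (u : Fin m) : Fin n ⊕ Fin n ⊕ M.OrderedEdge → ℝ :=
  Sum.elim (fun i => partialDeriv i (M.logDensity u) z)
    (Sum.elim (fun i => partialDeriv i (partialDeriv i (M.logDensity u)) z)
      (fun e => partialDeriv e.1.1 (partialDeriv e.1.2 (M.logDensity u)) z))

/-- Sufficient changes: at every `z` there are domains `u_0, …, u_{2n+|M_Z|}` such that the
`2n+|M_Z|` differences `w(z, u_k) - w(z, u_0)` are linearly independent. -/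
def SufficientChanges : Prop :=
  ∀ z : Fin n → ℝ, ∃ u : Fin (2 * n + M.numEdges + 1) → Fin m,
    LinearIndependent ℝ
      (fun k : Fin (2 * n + M.numEdges) => M.w z (u k.succ) - M.w z (u 0))

end CausalModel

end

/-! Compare the models through the transition map `ψ = M.g⁻¹ ∘ M'.g`, with Jacobian `J`. If `i`, `j`
are nonadjacent in the network of `M'`, the latent density of `M'` splits almost everywhere into a
factor free of `z_j` times a factor free of `z_i`. By change of variables this density is `|det J|`
times the density of `M` at `ψ`. Subtracting the logarithms for two domains cancels `log |det J|`,
which need not be `C²`, and leaves a `C²` function whose mixed partial `∂_i ∂_j` vanishes.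

Expanding by the chain rule gives a linear relation between the components of `w(ψ y, u) - w(ψ y,
v)`, because the mixed second derivatives of `M` off its edges vanish by the same splitting
argument. The coefficients do not depend on the domains, so sufficient changes force them to be
zero: `J_ki J_kj = 0` for all `k`, and `J_ki J_lj + J_li J_kj = 0` on every edge `{k, l}` of `M`
(`Matches.jacobian_relations`).

Since `det J ≠ 0`, some permutation has `J_{σ i, i} ≠ 0` for all `i`. If `{σ i, σ j}` were an edge
of `M` but `{i, j}` not one of `M'`, the first relation would give `J_{σ i, j} = 0` and the second
`J_{σ i, i} J_{σ j, j} = 0`, a contradiction. So `M` has, up to relabelling, a subgraph of the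
network of `M'`; minimality tested against `M` itself makes them equal.

The density of `M'` is only measurable and may vanish, so the images of the mixing maps may differ;
it suffices to work near one point, on an open set where `ψ` exists. -/

open scoped ENNReal

/-! ### Marginals and coordinate σ-algebras. -/

section Marginal

theorem lmarginal_mul_of_dependsOn_compl {ι : Type*} [DecidableEq ι] {s : Finset ι}
    {c f : (ι → ℝ) → ℝ≥0∞} (hc : ∀ x y, (∀ k ∉ s, x k = y k) → c x = c y) (hf : Measurable f) :
    (∫⋯∫⁻_s, (fun x => c x * f x) ∂fun _ => (volume : Measure ℝ)) =
      fun x => c x * (∫⋯∫⁻_s, f ∂fun _ => (volume : Measure ℝ)) x := by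
  ext x
  simp only [lmarginal]
  have hf' : Measurable fun y : s → ℝ => f (Function.updateFinset x s y) :=
    hf.comp measurable_updateFinset
  rw [← lintegral_const_mul _ hf']
  refine lintegral_congr fun y => ?_
  congr 1
  refine hc _ _ fun k hk => ?_
  simp [Function.updateFinset, hk]

variable {ι : Type*}

/-- The σ-algebra generated by the coordinates in `s`. -/
abbrev coordSigma (s : Set ι) : MeasurableSpace (ι → ℝ) :=
  MeasurableSpace.comap (fun (z : ι → ℝ) (k : s) => z k) inferInstance

theorem coordSigma_le (s : Set ι) : coordSigma s ≤ (inferInstance : MeasurableSpace (ι → ℝ)) :=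
  Measurable.comap_le (measurable_pi_lambda _ fun k => measurable_pi_apply k.1)

theorem mem_iff_of_measurableSet_coordSigma {s : Set ι} {B : Set (ι → ℝ)}
    (hB : MeasurableSet[coordSigma s] B) {x y : ι → ℝ} (h : ∀ k ∈ s, x k = y k) :
    x ∈ B ↔ y ∈ B := by
  obtain ⟨C, -, rfl⟩ := hB
  have : (fun k : s => x k) = fun k : s => y k := funext fun k => h k k.2
  simp only [Set.mem_preimage, this]

theorem measurable_coordSigma_of_dependsOn {β : Type*} [MeasurableSpace β] {s : Set ι}
    {c : (ι → ℝ) → β} (hc : Measurable c) (hd : ∀ x y, (∀ k ∈ s, x k = y k) → c x = c y) :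
    Measurable[coordSigma s] c := by
  classical
  let e : (s → ℝ) → ι → ℝ := fun w k => if h : k ∈ s then w ⟨k, h⟩ else 0
  have he : Measurable e := by
    refine measurable_pi_lambda _ fun k => ?_
    by_cases h : k ∈ s
    · simpa [e, h] using measurable_pi_apply _
    · simp [e, h]
  have : c = (c ∘ e) ∘ fun (z : ι → ℝ) (k : s) => z k := by
    ext x
    refine hd _ _ fun k hk => ?_
    simp [e, hk]
  rw [this]
  exact (hc.comp he).comp (comap_measurable _)

end Marginal

/-! ### Conditional independence as factorization of the density. -/

section Factorization

variable {n : ℕ} {ρ : (Fin n → ℝ) → ℝ≥0∞}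

/-- The marginal of `f` obtained by integrating out the coordinates in `s`. -/
noncomputable def marg (s : Finset (Fin n)) (f : (Fin n → ℝ) → ℝ≥0∞) : (Fin n → ℝ) → ℝ≥0∞ :=
  ∫⋯∫⁻_s, f ∂fun _ => (volume : Measure ℝ)

theorem Measurable.marg {s : Finset (Fin n)} {f : (Fin n → ℝ) → ℝ≥0∞} (hf : Measurable f) :
    Measurable (marg s f) := hf.lmarginal _

theorem marg_mono {s : Finset (Fin n)} {f g : (Fin n → ℝ) → ℝ≥0∞} (hfg : f ≤ g) :
    marg s f ≤ marg s g := lmarginal_mono hfg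

theorem marg_mul {s : Finset (Fin n)} {c f : (Fin n → ℝ) → ℝ≥0∞}
    (hc : ∀ x y, (∀ k ∉ s, x k = y k) → c x = c y) (hf : Measurable f) :
    marg s (fun x => c x * f x) = fun x => c x * marg s f x :=
  lmarginal_mul_of_dependsOn_compl hc hf

theorem lintegral_eq_of_marg_eq (s : Finset (Fin n)) {f g : (Fin n → ℝ) → ℝ≥0∞}
    (hf : Measurable f) (hg : Measurable g) (hfg : marg s f = marg s g) :
    ∫⁻ x, f x = ∫⁻ x, g x :=
  lintegral_eq_of_lmarginal_eq s hf hg hfg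

theorem marg_dependsOn (s : Finset (Fin n)) (f : (Fin n → ℝ) → ℝ≥0∞) (x y : Fin n → ℝ)
    (h : ∀ k ∉ s, x k = y k) : marg s f x = marg s f y :=
  lmarginal_congr _ f h

/-- On the set `B` where the marginal is infinite, `ρ` and `2ρ` have the same marginal. As `B`
ignores the coordinates in `s`, its mass equals twice itself; being finite, it is zero. -/
theorem withDensity_marg_eq_top (s : Finset (Fin n)) (hρ : Measurable ρ) (hfin : ∫⁻ x, ρ x ≠ ∞) :
    volume.withDensity ρ {z | marg s ρ z = ∞} = 0 := by
  set B : Set (Fin n → ℝ) := {z | marg s ρ z = ∞}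
  have hm : Measurable (marg s ρ) := hρ.marg
  have hB : MeasurableSet B := hm (measurableSet_singleton _)
  have key : ∫⁻ x, B.indicator 1 x * ρ x = ∫⁻ x, (2 * B.indicator 1 x) * ρ x := by
    refine lintegral_eq_of_marg_eq s ((measurable_one.indicator hB).mul hρ)
      (((measurable_one.indicator hB).const_mul 2).mul hρ) ?_
    have hd : ∀ x y, (∀ k ∉ s, x k = y k) →
        B.indicator (1 : (Fin n → ℝ) → ℝ≥0∞) x = B.indicator 1 y := fun x y h => by
      have := marg_dependsOn s ρ x y h
      simp only [Set.indicator, B, Set.mem_ofPred_eq, this, Pi.one_apply]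
    rw [marg_mul hd hρ, marg_mul (fun x y h => by rw [hd x y h]) hρ]
    ext x
    by_cases hx : x ∈ B
    · have : marg s ρ x = ∞ := hx
      simp [hx, this]
    · simp [hx]
  have e1 : ∫⁻ x, B.indicator 1 x * ρ x = volume.withDensity ρ B := by
    rw [withDensity_apply _ hB, ← lintegral_indicator hB]
    refine lintegral_congr fun x => ?_
    by_cases hx : x ∈ B <;> simp [hx]
  have e2 : ∫⁻ x, (2 * B.indicator 1 x) * ρ x = 2 * volume.withDensity ρ B := by
    rw [← e1, ← lintegral_const_mul _ (by exact (measurable_one.indicator hB).mul hρ)]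
    simp only [mul_assoc]
  rw [e1, e2, two_mul] at key
  have hle : volume.withDensity ρ B ≠ ∞ := by
    refine ne_top_of_le_ne_top hfin ?_
    rw [withDensity_apply _ hB]
    exact setLIntegral_le_lintegral _ _
  by_contra h0
  exact (ENNReal.lt_add_right hle h0).ne key

/-- The ratio is the conditional probability of `A` given the coordinates outside `s`. It is
constant along `s`, so integrating `s` out of ratio times `ρ` cancels the denominator. -/
theorem setLIntegral_marg_div (s : Finset (Fin n)) (hρ : Measurable ρ) (hfin : ∫⁻ x, ρ x ≠ ∞)
    {A B : Set (Fin n → ℝ)} (hA : MeasurableSet A)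
    (hB : MeasurableSet[coordSigma ((s : Set (Fin n))ᶜ)] B) :
    ∫⁻ x in B, marg s (A.indicator ρ) x / marg s ρ x ∂volume.withDensity ρ =
      volume.withDensity ρ (A ∩ B) := by
  have hB' : MeasurableSet B := coordSigma_le _ _ hB
  have hm : Measurable (marg s ρ) := hρ.marg
  have hAρ : Measurable (A.indicator ρ) := hρ.indicator hA
  have hN : Measurable (marg s (A.indicator ρ)) := hAρ.marg
  set T : Set (Fin n → ℝ) := {z | marg s ρ z = ∞}
  have hT : MeasurableSet T := hm (measurableSet_singleton _)
  have hT0 := withDensity_marg_eq_top s hρ hfin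
  have hd : ∀ x y, (∀ k ∉ s, x k = y k) →
      (B \ T).indicator (1 : (Fin n → ℝ) → ℝ≥0∞) x = (B \ T).indicator 1 y := fun x y h => by
    have h1 := marg_dependsOn s ρ x y h
    have h2 := mem_iff_of_measurableSet_coordSigma hB (x := x) (y := y) (fun k hk => h k (by simpa using hk))
    have h3 : x ∈ B \ T ↔ y ∈ B \ T := by simp only [T, Set.mem_sdiff, Set.mem_ofPred_eq, h1, h2]
    by_cases hy : y ∈ B \ T
    · rw [Set.indicator_of_mem (h3.2 hy), Set.indicator_of_mem hy]; rfl
    · rw [Set.indicator_of_notMem (mt h3.1 hy), Set.indicator_of_notMem hy]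
  have hI : Measurable ((B \ T).indicator (1 : (Fin n → ℝ) → ℝ≥0∞)) :=
    measurable_one.indicator (hB'.diff hT)
  have key : ∫⁻ x, ((B \ T).indicator 1 x * (marg s (A.indicator ρ) x / marg s ρ x)) * ρ x =
      ∫⁻ x, (B \ T).indicator 1 x * A.indicator ρ x := by
    refine lintegral_eq_of_marg_eq s ((hI.mul (hN.div hm)).mul hρ) (hI.mul hAρ) ?_
    rw [marg_mul
      (fun x y h => by rw [hd x y h, marg_dependsOn s _ x y h, marg_dependsOn s ρ x y h]) hρ,
      marg_mul hd hAρ]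
    ext x
    rw [mul_assoc]
    by_cases hx : x ∈ B \ T
    · congr 1
      -- A zero denominator forces a zero numerator by monotonicity; an infinite one is excluded by
      -- removing `T`.
      refine ENNReal.div_mul_cancel' (fun h => ?_) (fun h => absurd h hx.2)
      refine le_antisymm ((marg_mono (Set.indicator_le_self A ρ) x).trans h.le) zero_le
    · simp [hx]
  have hBT : (B \ T : Set _) =ᵐ[volume.withDensity ρ] B := sdiff_null_ae_eq_self hT0
  have hBT' : (A ∩ (B \ T) : Set _) =ᵐ[volume.withDensity ρ] (A ∩ B : Set _) :=
    (ae_eq_refl A).inter hBT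
  rw [← setLIntegral_congr hBT, ← measure_congr hBT', withDensity_apply _ (hA.inter (hB'.diff hT)),
    ← lintegral_indicator (hB'.diff hT), ← lintegral_indicator (hA.inter (hB'.diff hT)),
    lintegral_withDensity_eq_lintegral_mul _ hρ (by exact (hN.div hm).indicator (hB'.diff hT))]
  refine Eq.trans (lintegral_congr fun x => ?_) (key.trans (lintegral_congr fun x => ?_))
  · by_cases hx : x ∈ B \ T <;> simp [hx, mul_comm]
  · by_cases hx : x ∈ B \ T <;> by_cases hx' : x ∈ A <;> simp [Set.indicator, hx, hx']

theorem condExp_indicator_eq_marg_div (s : Finset (Fin n)) (hρ : Measurable ρ)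
    [IsFiniteMeasure (volume.withDensity ρ)] {A : Set (Fin n → ℝ)} (hA : MeasurableSet A) :
    (fun x => (marg s (A.indicator ρ) x / marg s ρ x).toReal) =ᵐ[volume.withDensity ρ]
      (volume.withDensity ρ)⟦A | coordSigma ((s : Set (Fin n))ᶜ)⟧ := by
  have hfin : ∫⁻ x, ρ x ≠ ∞ := by
    have := measure_ne_top (volume.withDensity ρ) Set.univ
    rwa [withDensity_apply _ MeasurableSet.univ, setLIntegral_univ] at this
  have hm : Measurable (marg s ρ) := hρ.marg
  have hN : Measurable (marg s (A.indicator ρ)) := (hρ.indicator hA).marg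
  have hle : ∀ x, marg s (A.indicator ρ) x / marg s ρ x ≤ 1 := fun x =>
    (ENNReal.div_le_div_right (marg_mono (Set.indicator_le_self A ρ) x) _).trans
      ENNReal.div_self_le_one
  have hint : ∀ B, MeasurableSet[coordSigma ((s : Set (Fin n))ᶜ)] B →
      ∫⁻ x in B, marg s (A.indicator ρ) x / marg s ρ x ∂volume.withDensity ρ ≠ ∞ := fun B hB => by
    rw [setLIntegral_marg_div s hρ hfin hA hB]; exact measure_ne_top _ _
  refine ae_eq_condExp_of_forall_setIntegral_eq (coordSigma_le _) ?_ ?_ ?_ ?_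
  · exact (integrable_const 1).indicator hA
  · intro B hB _
    exact integrable_toReal_of_lintegral_ne_top (hN.div hm).aemeasurable (hint B hB)
  · intro B hB _
    rw [integral_toReal (by exact (hN.div hm).aemeasurable)
        (ae_of_all _ fun x => (hle x).trans_lt ENNReal.one_lt_top),
      setLIntegral_marg_div s hρ hfin hA hB, integral_indicator hA,
      Measure.restrict_restrict hA]
    simp [Measure.real]
  · refine Measurable.aestronglyMeasurable ?_
    refine measurable_coordSigma_of_dependsOn (hN.div hm).ennreal_toReal fun x y h => ?_
    have h' : ∀ k ∉ s, x k = y k := fun k hk => h k (by simpa using hk)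
    rw [marg_dependsOn s _ x y h', marg_dependsOn s ρ x y h']

theorem marg_pair {i j : Fin n} (hij : i ≠ j) {f : (Fin n → ℝ) → ℝ≥0∞} (hf : Measurable f) :
    marg {i, j} f = marg {i} (marg {j} f) :=
  lmarginal_union (fun _ => (volume : Measure ℝ)) f hf (Finset.disjoint_singleton.2 hij)

theorem indicator_eval_dependsOn {i : Fin n} {s : Finset (Fin n)} (hi : i ∉ s) (S : Set ℝ)
    (x y : Fin n → ℝ) (h : ∀ k ∉ s, x k = y k) :
    (Function.eval i ⁻¹' S : Set (Fin n → ℝ)).indicator (1 : (Fin n → ℝ) → ℝ≥0∞) x =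
      (Function.eval i ⁻¹' S : Set (Fin n → ℝ)).indicator 1 y := by
  by_cases hy : y i ∈ S
  · rw [Set.indicator_of_mem (by simpa [h i hi] using hy), Set.indicator_of_mem (by exact hy)]; rfl
  · rw [Set.indicator_of_notMem (by simpa [h i hi] using hy), Set.indicator_of_notMem (by exact hy)]

theorem indicator_eq_mul (A : Set (Fin n → ℝ)) (f : (Fin n → ℝ) → ℝ≥0∞) :
    A.indicator f = fun x => A.indicator 1 x * f x := by
  ext x
  by_cases hx : x ∈ A <;> simp [hx]

theorem marg_indicator_eval {i : Fin n} {s : Finset (Fin n)} (hi : i ∉ s) {S : Set ℝ}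
    (hρ : Measurable ρ) :
    marg s ((Function.eval i ⁻¹' S : Set (Fin n → ℝ)).indicator ρ) =
      (Function.eval i ⁻¹' S : Set (Fin n → ℝ)).indicator (marg s ρ) := by
  rw [indicator_eq_mul, indicator_eq_mul _ (marg s ρ), marg_mul (indicator_eval_dependsOn hi S) hρ]

theorem marg_pair_mul {i j : Fin n} (hij : i ≠ j) (hρ : Measurable ρ) {S T : Set ℝ}
    (hS : MeasurableSet S) (hT : MeasurableSet T) :
    marg {i, j} (fun x =>
      (Function.eval i ⁻¹' S : Set (Fin n → ℝ)).indicator (marg {j} ρ) x *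
      (Function.eval j ⁻¹' T : Set (Fin n → ℝ)).indicator (marg {i} ρ) x) =
    fun x => marg {i, j} ((Function.eval i ⁻¹' S).indicator ρ) x *
      marg {i, j} ((Function.eval j ⁻¹' T).indicator ρ) x := by
  have hS' : MeasurableSet (Function.eval i ⁻¹' S : Set (Fin n → ℝ)) := measurable_pi_apply i hS
  have hT' : MeasurableSet (Function.eval j ⁻¹' T : Set (Fin n → ℝ)) := measurable_pi_apply j hT
  have hSρ := hρ.indicator hS'
  have hTρ := hρ.indicator hT'
  rw [← marg_indicator_eval (by simpa using hij) hρ, ← marg_indicator_eval (by simpa using hij.symm) hρ,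
    marg_pair hij (by exact hSρ.marg.mul hTρ.marg), marg_mul (marg_dependsOn _ _) hTρ.marg,
    ← marg_pair hij.symm hTρ, Finset.pair_comm j i]
  have := marg_mul (s := {i}) (c := marg {i, j} ((Function.eval j ⁻¹' T).indicator ρ))
    (f := marg {j} ((Function.eval i ⁻¹' S).indicator ρ))
    (fun x y h => marg_dependsOn _ _ x y fun k hk => h k (by simp at hk ⊢; tauto)) hSρ.marg
  simp only [mul_comm] at this ⊢
  rw [this, marg_pair hij hSρ]

/-- The factors come from `p(z) = p(z_{-j}) p(z_{-i}) / p(z_{-ij})`. Both sides give the same mass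
to boxes, a π-system generating the Borel sets. -/
theorem CoordCondIndep.exists_factorization {i j : Fin n} (hij : i ≠ j) (hρ : Measurable ρ)
    [IsFiniteMeasure (volume.withDensity ρ)]
    (h : CoordCondIndep (volume.withDensity ρ) i j {i, j}ᶜ) :
    ∃ a b : (Fin n → ℝ) → ℝ≥0∞, (∀ z t, a (Function.update z j t) = a z) ∧
      (∀ z t, b (Function.update z i t) = b z) ∧ ρ =ᵐ[volume] fun z => a z * b z := by
  set μ := volume.withDensity ρ with hμ
  have hfin : ∫⁻ x, ρ x ≠ ∞ := by
    have := measure_ne_top μ Set.univ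
    rwa [withDensity_apply _ MeasurableSet.univ, setLIntegral_univ] at this
  have hj := hρ.marg (s := {j})
  have hi := hρ.marg (s := {i})
  have hm := hρ.marg (s := {i, j})
  have hab : Measurable fun z => marg {j} ρ z * (marg {i} ρ z / marg {i, j} ρ z) :=
    hj.mul (hi.div hm)
  refine ⟨marg {j} ρ, fun z => marg {i} ρ z / marg {i, j} ρ z, fun z t => ?_, fun z t => ?_, ?_⟩
  · exact lmarginal_update_of_mem _ (by simp) _ _ _
  · exact congrArg₂ _ (lmarginal_update_of_mem _ (by simp) _ _ _)
      (lmarginal_update_of_mem _ (by simp) _ _ _)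
  have hset : ((({i, j} : Finset (Fin n)) : Set (Fin n))ᶜ) = {i, j}ᶜ := by simp
  rw [CoordCondIndep, condIndepFun_iff_condExp_inter_preimage_eq_mul (measurable_pi_apply i)
    (measurable_pi_apply j)] at h
  have key : ∀ S T : Set ℝ, MeasurableSet S → MeasurableSet T →
      ∀ B, MeasurableSet[coordSigma ({i, j}ᶜ : Set (Fin n))] B →
      volume.withDensity ρ (Function.eval i ⁻¹' S ∩ Function.eval j ⁻¹' T ∩ B) =
      volume.withDensity (fun z => marg {j} ρ z * (marg {i} ρ z / marg {i, j} ρ z))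
        (Function.eval i ⁻¹' S ∩ Function.eval j ⁻¹' T ∩ B) := by
    intro S T hS hT B hB
    have hB' : MeasurableSet B := coordSigma_le _ _ hB
    have hS' : MeasurableSet (Function.eval i ⁻¹' S : Set (Fin n → ℝ)) := measurable_pi_apply i hS
    have hT' : MeasurableSet (Function.eval j ⁻¹' T : Set (Fin n → ℝ)) := measurable_pi_apply j hT
    have hNS := (hρ.indicator hS').marg (s := {i, j})
    have hNT := (hρ.indicator hT').marg (s := {i, j})
    have hle : ∀ (A : Set (Fin n → ℝ)) x,
        marg {i, j} (A.indicator ρ) x / marg {i, j} ρ x ≤ 1 := fun A x =>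
      (ENNReal.div_le_div_right (marg_mono (Set.indicator_le_self A ρ) x) _).trans
        ENNReal.div_self_le_one
    have hne : ∀ (A : Set (Fin n → ℝ)) x,
        marg {i, j} (A.indicator ρ) x / marg {i, j} ρ x ≠ ∞ := fun A x =>
      ((hle A x).trans_lt ENNReal.one_lt_top).ne
    have hprod : ∀ᵐ x ∂μ,
        marg {i, j} ((Function.eval i ⁻¹' S ∩ Function.eval j ⁻¹' T).indicator ρ) x /
            marg {i, j} ρ x =
          marg {i, j} ((Function.eval i ⁻¹' S).indicator ρ) x / marg {i, j} ρ x *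
          (marg {i, j} ((Function.eval j ⁻¹' T).indicator ρ) x / marg {i, j} ρ x) := by
      have h1 := condExp_indicator_eq_marg_div {i, j} hρ (hS'.inter hT')
      have h2 := condExp_indicator_eq_marg_div {i, j} hρ hS'
      have h3 := condExp_indicator_eq_marg_div {i, j} hρ hT'
      rw [hset] at h1 h2 h3
      filter_upwards [h1, h2, h3, h S T hS hT] with x e1 e2 e3 e4
      rw [← ENNReal.toReal_eq_toReal_iff' (hne _ x) (ENNReal.mul_ne_top (hne _ x) (hne _ x)),
        ENNReal.toReal_mul, e1, e2, e3]
      exact e4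
    have hd : ∀ x y, (∀ k ∉ ({i, j} : Finset (Fin n)), x k = y k) →
        B.indicator (1 : (Fin n → ℝ) → ℝ≥0∞) x = B.indicator 1 y := fun x y hxy => by
      have h3 : x ∈ B ↔ y ∈ B :=
        mem_iff_of_measurableSet_coordSigma hB fun k hk => hxy k (by simpa using hk)
      by_cases hy : y ∈ B
      · rw [Set.indicator_of_mem (h3.2 hy), Set.indicator_of_mem hy]; rfl
      · rw [Set.indicator_of_notMem (mt h3.1 hy), Set.indicator_of_notMem hy]
    have hI : Measurable (B.indicator (1 : (Fin n → ℝ) → ℝ≥0∞)) := measurable_one.indicator hB'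
    rw [← setLIntegral_marg_div {i, j} hρ hfin (hS'.inter hT') (by rwa [hset]),
      setLIntegral_congr_fun_ae hB' (hprod.mono fun x hx _ => hx),
      ← lintegral_indicator hB',
      lintegral_withDensity_eq_lintegral_mul _ hρ
        (by exact ((hNS.div hm).mul (hNT.div hm)).indicator hB'),
      withDensity_apply _ ((hS'.inter hT').inter hB'),
      ← lintegral_indicator ((hS'.inter hT').inter hB')]
    trans ∫⁻ x, (B.indicator 1 x *
        (marg {i, j} ((Function.eval i ⁻¹' S).indicator ρ) x / marg {i, j} ρ x *
          (marg {i, j} ((Function.eval j ⁻¹' T).indicator ρ) x / marg {i, j} ρ x))) * ρ x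
    · refine lintegral_congr fun x => ?_
      by_cases hx : x ∈ B <;> simp [hx, mul_comm]
    -- Both integrands have the same marginal over `{i, j}`, namely `c p q / r` for `r ≠ 0, ∞`;
    -- otherwise both marginals vanish.
    trans ∫⁻ x, (B.indicator 1 x * (marg {i, j} ρ x)⁻¹) *
      ((Function.eval i ⁻¹' S : Set (Fin n → ℝ)).indicator (marg {j} ρ) x *
      (Function.eval j ⁻¹' T : Set (Fin n → ℝ)).indicator (marg {i} ρ) x)
    · refine lintegral_eq_of_marg_eq {i, j} ((hI.mul ((hNS.div hm).mul (hNT.div hm))).mul hρ)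
        ((hI.mul hm.inv).mul ((hj.indicator hS').mul (hi.indicator hT'))) ?_
      rw [marg_mul (fun x y hxy => by
          rw [hd x y hxy, marg_dependsOn _ _ x y hxy, marg_dependsOn _ ρ x y hxy,
            marg_dependsOn _ ((Function.eval j ⁻¹' T).indicator ρ) x y hxy]) hρ,
        marg_mul (fun x y hxy => by rw [hd x y hxy, marg_dependsOn _ ρ x y hxy])
          (by exact (hj.indicator hS').mul (hi.indicator hT')), marg_pair_mul hij hρ hS hT]
      ext x
      beta_reduce
      have h0 := marg_mono (s := {i, j}) (Set.indicator_le_self (Function.eval i ⁻¹' S) ρ) x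
      generalize marg {i, j} ((Function.eval i ⁻¹' S).indicator ρ) x = p at h0 ⊢
      generalize marg {i, j} ((Function.eval j ⁻¹' T).indicator ρ) x = q
      generalize marg {i, j} ρ x = r at h0 ⊢
      generalize B.indicator (1 : (Fin n → ℝ) → ℝ≥0∞) x = c
      rcases eq_or_ne r 0 with rfl | hr
      · simp [le_antisymm h0 zero_le]
      rcases eq_or_ne r ∞ with rfl | hr'
      · simp
      · calc c * (p / r * (q / r)) * r = c * p * q * r⁻¹ * (r⁻¹ * r) := by
              simp only [div_eq_mul_inv]; ring
          _ = _ := by rw [ENNReal.inv_mul_cancel hr hr']; ring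
    · refine lintegral_congr fun x => ?_
      by_cases h1 : x ∈ B <;> by_cases h2 : x i ∈ S <;> by_cases h3 : x j ∈ T <;>
        simp [Set.indicator, h1, h2, h3, div_eq_mul_inv]
      ring
  rw [← withDensity_eq_iff hρ.aemeasurable hab.aemeasurable hfin]
  have hbox : ∀ s : Fin n → Set ℝ, Set.univ.pi s = Function.eval i ⁻¹' s i ∩ Function.eval j ⁻¹' s j ∩
      {z | ∀ k ∈ ({i, j}ᶜ : Set (Fin n)), z k ∈ s k} := fun s => by
    ext z
    simp only [Set.mem_pi, Set.mem_univ, true_imp_iff, Set.mem_inter_iff, Set.mem_preimage,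
      Function.eval, Set.mem_compl_iff, Set.mem_insert_iff, Set.mem_singleton_iff, not_or,
      Set.mem_ofPred_eq]
    refine ⟨fun hz => ⟨⟨hz i, hz j⟩, fun k _ => hz k⟩, fun hz k => ?_⟩
    by_cases hki : k = i
    · exact hki ▸ hz.1.1
    by_cases hkj : k = j
    · exact hkj ▸ hz.1.2
    exact hz.2 k ⟨hki, hkj⟩
  have heq : ∀ s : Fin n → Set ℝ, (∀ k, MeasurableSet (s k)) →
      volume.withDensity ρ (Set.univ.pi s) =
      volume.withDensity (fun z => marg {j} ρ z * (marg {i} ρ z / marg {i, j} ρ z))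
        (Set.univ.pi s) := fun s hs => by
    rw [hbox s]
    refine key _ _ (hs i) (hs j) _ ?_
    refine ⟨Set.univ.pi fun k => s k, MeasurableSet.univ_pi fun k => hs k, ?_⟩
    ext z
    simp
  refine ext_of_generate_finite _ generateFrom_pi.symm isPiSystem_pi ?_ ?_
  · rintro _ ⟨s, hs, rfl⟩
    exact heq s fun k => hs k (Set.mem_univ k)
  · simpa using heq (fun _ => Set.univ) fun _ => MeasurableSet.univ

end Factorization

/-! ### Mixed partials of additively split functions; second-order chain rule. -/

section MixedPartials

open CausalModel Topology

variable {n : ℕ}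

theorem add_smul_single_eq_update (y : Fin n → ℝ) (j : Fin n) (t : ℝ) :
    y + t • Pi.single j (1 : ℝ) = Function.update y j (y j + t) := by
  ext k
  by_cases hk : k = j
  · subst hk; simp
  · simp [hk]

/-- `α` and `β` have no regularity, so they are eliminated by a second difference. It vanishes for
almost every base point, since translates of null sets are null, and then for every one by
continuity of `L`. The radius `3 * r` leaves room for a base point within `r` and a displacement
below `2 * r`. -/
theorem eq_add_sub_of_ae_eq_add {V : Set (Fin n → ℝ)} {L α β : (Fin n → ℝ) → ℝ}
    {i j : Fin n} (hL : ContinuousOn L V) (hα : ∀ z t, α (Function.update z j t) = α z)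
    (hβ : ∀ z t, β (Function.update z i t) = β z) (h : ∀ᵐ y, y ∈ V → L y = α y + β y)
    {y : Fin n → ℝ} {r : ℝ} (hr : 0 < r) (hV : Metric.ball y (3 * r) ⊆ V) {s t : ℝ}
    (hs : |s| < r) (ht : |t| < r) :
    L (y + s • Pi.single i 1 + t • Pi.single j 1) =
      L (y + s • Pi.single i 1) + L (y + t • Pi.single j 1) - L y := by
  have hα' : ∀ z t, α (z + t • Pi.single j (1 : ℝ)) = α z := fun z (t : ℝ) => by
    rw [add_smul_single_eq_update, hα]
  have hβ' : ∀ z t, β (z + t • Pi.single i (1 : ℝ)) = β z := fun z (t : ℝ) => by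
    rw [add_smul_single_eq_update, hβ]
  set v : Fin n → ℝ := s • Pi.single i 1
  set w : Fin n → ℝ := t • Pi.single j 1
  have hv : ‖v‖ < r := by
    rw [norm_smul, Pi.norm_single]; simpa using hs
  have hw : ‖w‖ < r := by
    rw [norm_smul, Pi.norm_single]; simpa using ht
  have hmem : ∀ x ∈ Metric.ball y r, ∀ u : Fin n → ℝ, ‖u‖ < 2 * r → x + u ∈ V := fun x hx u hu => by
    refine hV ?_
    rw [Metric.mem_ball, dist_eq_norm] at hx ⊢
    calc ‖x + u - y‖ = ‖(x - y) + u‖ := by congr 1; abel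
      _ ≤ ‖x - y‖ + ‖u‖ := norm_add_le _ _
      _ < 3 * r := by linarith
  have h0 : ∀ x ∈ Metric.ball y r, x ∈ V := fun x hx => by
    simpa using hmem x hx 0 (by simpa using hr)
  have h1 : ∀ x ∈ Metric.ball y r, x + v ∈ V := fun x hx => hmem x hx v (by linarith)
  have h2 : ∀ x ∈ Metric.ball y r, x + w ∈ V := fun x hx => hmem x hx w (by linarith)
  have h3 : ∀ x ∈ Metric.ball y r, x + (v + w) ∈ V := fun x hx =>
    hmem x hx _ ((norm_add_le _ _).trans_lt (by linarith))
  have htrans : ∀ u : Fin n → ℝ, ∀ᵐ x, x + u ∈ V → L (x + u) = α (x + u) + β (x + u) := fun u =>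
    (measurePreserving_add_right volume u).quasiMeasurePreserving.ae h
  have hcont : ∀ u : Fin n → ℝ, (∀ x ∈ Metric.ball y r, x + u ∈ V) →
      ContinuousOn (fun x => L (x + u)) (Metric.ball y r) := fun u hu =>
    hL.comp (by fun_prop) hu
  have key : Set.EqOn (fun x => L (x + (v + w))) (fun x => L (x + v) + L (x + w) - L x)
      (Metric.ball y r) := by
    refine Measure.eqOn_open_of_ae_eq (μ := volume) ?_ Metric.isOpen_ball (hcont _ h3)
      (((hcont _ h1).add (hcont _ h2)).sub (hL.mono h0))
    refine (ae_restrict_iff' measurableSet_ball).2 ?_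
    filter_upwards [h, htrans v, htrans w, htrans (v + w)] with x e0 e1 e2 e3 hx
    rw [e0 (h0 x hx), e1 (h1 x hx), e2 (h2 x hx), e3 (h3 x hx), ← add_assoc]
    simp only [v, w, hα', hβ']
    rw [add_right_comm x, hβ']
    ring
  have := key (Metric.mem_ball_self hr)
  simpa only [add_assoc] using this

theorem ContDiffAt.differentiableAt_partialDeriv {L : (Fin n → ℝ) → ℝ} {y : Fin n → ℝ}
    (hL : ContDiffAt ℝ 2 L y) (j : Fin n) : DifferentiableAt ℝ (partialDeriv j L) y := by
  have : ContDiffAt ℝ 1 (fderiv ℝ L) y := hL.fderiv_right (by norm_num)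
  exact (this.differentiableAt (by norm_num)).clm_apply (differentiableAt_const _)

theorem partialDeriv_congr {L L' : (Fin n → ℝ) → ℝ} {y : Fin n → ℝ} (h : L =ᶠ[𝓝 y] L')
    (i : Fin n) : partialDeriv i L y = partialDeriv i L' y := by
  rw [partialDeriv, h.fderiv_eq, partialDeriv]

theorem partialDeriv_partialDeriv_eq_zero_of_ae_eq_add {V : Set (Fin n → ℝ)} (hVo : IsOpen V)
    {L α β : (Fin n → ℝ) → ℝ}
    {i j : Fin n} (hL : ContDiffOn ℝ 2 L V) (hα : ∀ z t, α (Function.update z j t) = α z)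
    (hβ : ∀ z t, β (Function.update z i t) = β z) (h : ∀ᵐ y, y ∈ V → L y = α y + β y)
    {y : Fin n → ℝ} (hy : y ∈ V) : partialDeriv i (partialDeriv j L) y = 0 := by
  obtain ⟨r', hr', hball⟩ := Metric.isOpen_iff.1 hVo y hy
  obtain ⟨r, hr, rfl⟩ : ∃ r, 0 < r ∧ 3 * r = r' := ⟨r' / 3, by positivity, by ring⟩
  have hLat : ∀ x ∈ V, ContDiffAt ℝ 2 L x := fun x hx => hL.contDiffAt (hVo.mem_nhds hx)
  have hD : ∀ x ∈ V, HasDerivAt (fun t : ℝ => L (x + t • Pi.single j (1 : ℝ)))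
      (partialDeriv j L x) 0 := fun x hx =>
    ((hLat x hx).differentiableAt (by norm_num)).hasFDerivAt.hasLineDerivAt _
  have habs : ∀ᶠ s : ℝ in 𝓝 0, |s| < r := by
    filter_upwards [Metric.ball_mem_nhds (0 : ℝ) hr] with s hs
    simpa using hs
  have hconst : ∀ᶠ s : ℝ in 𝓝 0,
      partialDeriv j L (y + s • Pi.single i (1 : ℝ)) = partialDeriv j L y := by
    filter_upwards [habs] with s hs
    have hmem : y + s • Pi.single i (1 : ℝ) ∈ V := by
      refine hball ?_
      have : ‖s • (Pi.single i (1 : ℝ) : Fin n → ℝ)‖ < r := by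
        rw [norm_smul, Pi.norm_single]; simpa using hs
      rw [Metric.mem_ball, dist_eq_norm, add_sub_cancel_left]
      linarith
    refine (hD _ hmem).unique ?_
    have := ((hD y hy).const_add (L (y + s • Pi.single i (1 : ℝ)))).sub_const (L y)
    refine this.congr_of_eventuallyEq ?_
    filter_upwards [habs] with t ht
    exact eq_add_sub_of_ae_eq_add hL.continuousOn hα hβ h hr hball hs ht
  have h1 : HasDerivAt (fun s : ℝ => partialDeriv j L (y + s • Pi.single i (1 : ℝ)))
      (partialDeriv i (partialDeriv j L) y) 0 :=
    ((hLat y hy).differentiableAt_partialDeriv j).hasFDerivAt.hasLineDerivAt _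
  exact h1.unique ((hasDerivAt_const (0 : ℝ) (partialDeriv j L y)).congr_of_eventuallyEq hconst)

theorem partialDeriv_comm {L : (Fin n → ℝ) → ℝ} {y : Fin n → ℝ} (hL : ContDiffAt ℝ 2 L y)
    (i j : Fin n) : partialDeriv i (partialDeriv j L) y = partialDeriv j (partialDeriv i L) y := by
  have hd : DifferentiableAt ℝ (fderiv ℝ L) y :=
    (hL.fderiv_right (m := 1) (by norm_num)).differentiableAt (by norm_num)
  have hp : ∀ i j : Fin n, partialDeriv i (partialDeriv j L) y =
      fderiv ℝ (fderiv ℝ L) y (Pi.single i 1) (Pi.single j 1) := fun i j => by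
    unfold partialDeriv
    rw [fderiv_clm_apply hd (differentiableAt_const _)]
    simp
  rw [hp, hp]
  exact hL.isSymmSndFDerivAt (by simp) _ _

theorem partialDeriv_sub {f g : (Fin n → ℝ) → ℝ} {y : Fin n → ℝ} (hf : DifferentiableAt ℝ f y)
    (hg : DifferentiableAt ℝ g y) (i : Fin n) :
    partialDeriv i (fun x => f x - g x) y = partialDeriv i f y - partialDeriv i g y := by
  simp only [partialDeriv]
  rw [fderiv_fun_sub hf hg, sub_apply]

theorem partialDeriv_comp {Q : (Fin n → ℝ) → ℝ} {ψ : (Fin n → ℝ) → (Fin n → ℝ)} {y : Fin n → ℝ}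
    (hQ : DifferentiableAt ℝ Q (ψ y)) (hψ : DifferentiableAt ℝ ψ y) (j : Fin n) :
    partialDeriv j (fun x => Q (ψ x)) y =
      ∑ l, partialDeriv l Q (ψ y) * partialDeriv j (fun x => ψ x l) y := by
  have h1 : fderiv ℝ (fun x => Q (ψ x)) y = (fderiv ℝ Q (ψ y)).comp (fderiv ℝ ψ y) :=
    fderiv_comp y hQ hψ
  have h2 : ∀ l, fderiv ℝ (fun x => ψ x l) y (Pi.single j 1) = fderiv ℝ ψ y (Pi.single j 1) l :=
    fun l => by rw [fderiv_apply hψ]; rfl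
  simp only [partialDeriv, h1, h2, ContinuousLinearMap.comp_apply]
  have := LinearMap.pi_apply_eq_sum_univ (fderiv ℝ Q (ψ y)).toLinearMap (fderiv ℝ ψ y (Pi.single j 1))
  simp only [ContinuousLinearMap.coe_coe, smul_eq_mul] at this
  rw [this]
  refine Finset.sum_congr rfl fun l _ => ?_
  rw [mul_comm]
  congr 2
  ext k
  simp [Pi.single_apply, eq_comm]

theorem partialDeriv_partialDeriv_comp {Q : (Fin n → ℝ) → ℝ} {ψ : (Fin n → ℝ) → (Fin n → ℝ)}
    {y : Fin n → ℝ} (hQ : ContDiff ℝ 2 Q) (hψ : ContDiffAt ℝ 2 ψ y) (i j : Fin n) :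
    partialDeriv i (partialDeriv j fun x => Q (ψ x)) y =
      ∑ l, partialDeriv l Q (ψ y) * partialDeriv i (partialDeriv j fun x => ψ x l) y +
      ∑ l, ∑ k, partialDeriv k (partialDeriv l Q) (ψ y) *
        (partialDeriv i (fun x => ψ x k) y * partialDeriv j (fun x => ψ x l) y) := by
  have hψd : DifferentiableAt ℝ ψ y := hψ.differentiableAt (by norm_num)
  have hev : (partialDeriv j fun x => Q (ψ x)) =ᶠ[𝓝 y]
      fun x => ∑ l, partialDeriv l Q (ψ x) * partialDeriv j (fun x => ψ x l) x := by
    filter_upwards [hψ.eventually (by simp)] with x hx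
    exact partialDeriv_comp (hQ.differentiable (by norm_num) _) (hx.differentiableAt (by norm_num)) j
  have hd1 : ∀ l, DifferentiableAt ℝ (partialDeriv l Q) (ψ y) := fun l =>
    hQ.contDiffAt.differentiableAt_partialDeriv l
  have hd1' : ∀ l, DifferentiableAt ℝ (fun x => partialDeriv l Q (ψ x)) y := fun l =>
    (hd1 l).comp y hψd
  have hd2 : ∀ l, DifferentiableAt ℝ (partialDeriv j fun x => ψ x l) y := fun l =>
    ((contDiffAt_pi.1 hψ) l).differentiableAt_partialDeriv j
  rw [partialDeriv_congr hev, partialDeriv,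
    fderiv_fun_sum (A := fun l x => partialDeriv l Q (ψ x) * partialDeriv j (fun x => ψ x l) x)
      fun l _ => (hd1' l).mul (hd2 l), ← Finset.sum_add_distrib, sum_apply]
  refine Finset.sum_congr rfl fun l _ => ?_
  rw [fderiv_fun_mul (hd1' l) (hd2 l)]
  simp only [add_apply, smul_apply, smul_eq_mul]
  have := partialDeriv_comp (hd1 l) hψd i
  rw [partialDeriv] at this
  rw [this, partialDeriv, Finset.mul_sum]
  congr 1
  refine Finset.sum_congr rfl fun k _ => ?_
  ring

end MixedPartials

/-! ### The transition map between two mixing maps. -/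

section Diffeo

open Topology

variable {n d : ℕ} {g g' : (Fin n → ℝ) → (Fin d → ℝ)}

theorem fderiv_injective_of_eventuallyEq_comp {E F G : Type*} [NormedAddCommGroup E]
    [NormedSpace ℝ E] [NormedAddCommGroup F] [NormedSpace ℝ F] [NormedAddCommGroup G]
    [NormedSpace ℝ G] {f : E → G} {p : E → F} {q : F → G} {x : E} (hp : DifferentiableAt ℝ p x)
    (hq : DifferentiableAt ℝ q (p x)) (h : (fun y => q (p y)) =ᶠ[𝓝 x] f)
    (hf : Function.Injective (fderiv ℝ f x)) : Function.Injective (fderiv ℝ p x) := by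
  have : fderiv ℝ f x = (fderiv ℝ q (p x)).comp (fderiv ℝ p x) := by
    rw [← h.fderiv_eq]; exact fderiv_comp x hq hp
  rw [this] at hf
  exact Function.Injective.of_comp hf

theorem IsC2DiffeoOntoImage.injective (hg : IsC2DiffeoOntoImage g) : Function.Injective g :=
  hg.2.elim fun _ h => h.1.injective

theorem IsC2DiffeoOntoImage.differentiableAt (hg : IsC2DiffeoOntoImage g) (x : Fin n → ℝ) :
    DifferentiableAt ℝ g x := hg.1.differentiable (by norm_num) x

theorem IsC2DiffeoOntoImage.fderiv_injective (hg : IsC2DiffeoOntoImage g) (x : Fin n → ℝ) :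
    Function.Injective (fderiv ℝ g x) := by
  obtain ⟨h, hl, hh⟩ := hg.2
  have h1 : HasFDerivWithinAt h (fderivWithin ℝ h (Set.range g) (g x)) (Set.range g) (g x) :=
    ((hh.differentiableOn (by norm_num)) (g x) ⟨x, rfl⟩).hasFDerivWithinAt
  have h2 := h1.comp_hasFDerivAt x (hg.differentiableAt x).hasFDerivAt
    (Filter.Eventually.of_forall fun y => ⟨y, rfl⟩)
  have h3 : h ∘ g = id := funext hl
  rw [h3] at h2
  have h4 := h2.unique (hasFDerivAt_id x)
  refine Function.LeftInverse.injective (g := fderivWithin ℝ h (Set.range g) (g x)) fun v => ?_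
  simpa using congrArg (fun T => T v) h4

/-- The range of `g'` need not be closed, but images of closed balls are compact. Near a point of
the preimage, a dense subset lands in such an image, hence so does the whole neighbourhood. -/
theorem IsC2DiffeoOntoImage.isOpen_preimage_range_of_dense (hg : Continuous g)
    (hg' : IsC2DiffeoOntoImage g') (hA : Dense (g ⁻¹' Set.range g')) :
    IsOpen (g ⁻¹' Set.range g') := by
  obtain ⟨h, hl, hh⟩ := hg'.2
  refine isOpen_iff_mem_nhds.2 fun x hx => ?_
  obtain ⟨y, hy⟩ := hx
  obtain ⟨O, hO, hOeq⟩ := continuousOn_iff'.1 hh.continuousOn (Metric.ball y 1) Metric.isOpen_ball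
  have hxO : x ∈ g ⁻¹' O := by
    have : g x ∈ h ⁻¹' Metric.ball y 1 ∩ Set.range g' := by
      rw [← hy]
      exact ⟨by simp [hl y], ⟨y, rfl⟩⟩
    rw [hOeq] at this
    exact this.1
  have hK : IsClosed (g ⁻¹' (g' '' Metric.closedBall y 1)) :=
    (((isCompact_closedBall y 1).image hg'.1.continuous).isClosed).preimage hg
  have hsub : g ⁻¹' O ∩ g ⁻¹' Set.range g' ⊆ g ⁻¹' (g' '' Metric.closedBall y 1) := by
    rintro z ⟨hz1, w, hw⟩
    have : g z ∈ h ⁻¹' Metric.ball y 1 ∩ Set.range g' := by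
      rw [hOeq]; exact ⟨hz1, w, hw⟩
    have h1 := this.1
    rw [← hw, Set.mem_preimage, hl w] at h1
    exact ⟨w, Metric.ball_subset_closedBall h1, hw⟩
  have hsub' : g ⁻¹' O ⊆ g ⁻¹' Set.range g' :=
    (hA.open_subset_closure_inter (hO.preimage hg)).trans
      ((closure_minimal hsub hK).trans (Set.preimage_mono (Set.image_subset_range _ _)))
  exact Filter.mem_of_superset ((hO.preimage hg).mem_nhds hxO) hsub'

/-- `g'⁻¹ ∘ g` has an injective derivative between spaces of equal dimension, so it is open at a
point, and `V` lies in its image. -/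
theorem IsC2DiffeoOntoImage.exists_isOpen_mapsTo_range (hg : IsC2DiffeoOntoImage g)
    (hg' : IsC2DiffeoOntoImage g') (hA : Dense (g ⁻¹' Set.range g')) :
    ∃ V : Set (Fin n → ℝ), IsOpen V ∧ V.Nonempty ∧ Set.MapsTo g' V (Set.range g) := by
  have hAo := hg'.isOpen_preimage_range_of_dense hg.1.continuous hA
  obtain ⟨x, hx⟩ := hA.nonempty
  obtain ⟨h, hl, hh⟩ := hg'.2
  have hφ : ContDiffAt ℝ 2 (h ∘ g) x :=
    (hh.comp hg.1.contDiffOn (fun _ hz => hz)).contDiffAt (hAo.mem_nhds hx)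
  have hgφ : ∀ z ∈ g ⁻¹' Set.range g', g' (h (g z)) = g z := by
    rintro z ⟨w, hw⟩
    rw [← hw, hl w]
  have hinj : Function.Injective (fderiv ℝ (h ∘ g) x) :=
    fderiv_injective_of_eventuallyEq_comp (hφ.differentiableAt (by norm_num))
      (hg'.differentiableAt _) (Filter.eventually_of_mem (hAo.mem_nhds hx) hgφ)
      (hg.fderiv_injective x)
  have hsurj : (fderiv ℝ (h ∘ g) x).range = ⊤ :=
    LinearMap.range_eq_top.2 (LinearMap.injective_iff_surjective.1 hinj)
  have hmap := (hφ.hasStrictFDerivAt (by norm_num)).map_nhds_eq_of_surj hsurj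
  have himg : (h ∘ g) '' (g ⁻¹' Set.range g') ∈ 𝓝 ((h ∘ g) x) := by
    rw [← hmap]
    exact Filter.image_mem_map (hAo.mem_nhds hx)
  obtain ⟨V, hV, hVo, hxV⟩ := mem_nhds_iff.1 himg
  refine ⟨V, hVo, ⟨_, hxV⟩, fun y hy => ?_⟩
  obtain ⟨z, hz, rfl⟩ := hV hy
  exact ⟨z, (hgφ z hz).symm⟩

theorem IsC2DiffeoOntoImage.exists_transition (hg : IsC2DiffeoOntoImage g)
    (hg' : IsC2DiffeoOntoImage g') {V : Set (Fin n → ℝ)} (hV : IsOpen V)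
    (hmaps : Set.MapsTo g' V (Set.range g)) :
    ∃ ψ : (Fin n → ℝ) → (Fin n → ℝ), ContDiffOn ℝ 2 ψ V ∧ (∀ y ∈ V, g (ψ y) = g' y) ∧
      ∀ y ∈ V, Function.Injective (fderiv ℝ ψ y) := by
  obtain ⟨h, hl, hh⟩ := hg.2
  have hψ : ContDiffOn ℝ 2 (h ∘ g') V := hh.comp hg'.1.contDiffOn hmaps
  have heq : ∀ y ∈ V, g (h (g' y)) = g' y := fun y hy => by
    obtain ⟨x, hx⟩ := hmaps hy
    rw [← hx, hl x]
  exact ⟨h ∘ g', hψ, heq, fun y hy => fderiv_injective_of_eventuallyEq_comp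
    ((hψ.contDiffAt (hV.mem_nhds hy)).differentiableAt (by norm_num)) (hg.differentiableAt _)
    (Filter.eventually_of_mem (hV.mem_nhds hy) heq) (hg'.fderiv_injective y)⟩

end Diffeo

/-! ### Change of variables between the latent laws. -/

namespace CausalModel

variable {n d m : ℕ} {M M' : CausalModel n d m}

theorem measurable_g (M : CausalModel n d m) : Measurable M.g := M.g_diffeo.1.continuous.measurable

theorem measurableSet_image_g (M : CausalModel n d m) {S : Set (Fin n → ℝ)}
    (hS : MeasurableSet S) : MeasurableSet (M.g '' S) :=
  hS.image_of_measurable_injOn M.measurable_g M.g_diffeo.injective.injOn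

theorem Matches.latentLaw_eq_preimage_image (h : M.Matches M') (u : Fin m) {S : Set (Fin n → ℝ)}
    (hS : MeasurableSet S) : M'.latentLaw u S = M.latentLaw u (M.g ⁻¹' (M'.g '' S)) := by
  have := congrArg (fun μ => μ (M'.g '' S)) (h u)
  simp only [observedLaw] at this
  rwa [Measure.map_apply M'.measurable_g (M'.measurableSet_image_g hS),
    Measure.map_apply M.measurable_g (M'.measurableSet_image_g hS),
    Set.preimage_image_eq _ M'.g_diffeo.injective] at this

/-- The preimage has full probability, and a positive density makes its complement Lebesgue null. -/
theorem Matches.dense_preimage_range (h : M.Matches M') (u : Fin m)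
    (hpos : ∀ z, 0 < M.density u z) : Dense (M.g ⁻¹' Set.range M'.g) := by
  have hmeas : MeasurableSet (M.g ⁻¹' Set.range M'.g) := by
    rw [← Set.image_univ]
    exact M.measurable_g (M'.measurableSet_image_g MeasurableSet.univ)
  have h1 : M.latentLaw u (M.g ⁻¹' Set.range M'.g)ᶜ = 0 := by
    rw [prob_compl_eq_zero_iff hmeas, ← Set.image_univ,
      ← h.latentLaw_eq_preimage_image u MeasurableSet.univ, measure_univ]
  rw [M.latentLaw_eq, withDensity_apply_eq_zero (M.density_measurable u).ennreal_ofReal] at h1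
  have h2 : {x | ENNReal.ofReal (M.density u x) ≠ 0} = Set.univ :=
    Set.eq_univ_of_forall fun x => by simpa using hpos x
  rw [h2, Set.univ_inter] at h1
  exact Measure.dense_of_ae h1

theorem Matches.density_eq_ae (h : M.Matches M') (u : Fin m) {V : Set (Fin n → ℝ)} (hV : IsOpen V)
    (hcont : Continuous (M.density u))
    {ψ : (Fin n → ℝ) → (Fin n → ℝ)} (hψ : ContDiffOn ℝ 2 ψ V) (hgψ : ∀ y ∈ V, M.g (ψ y) = M'.g y) :
    ∀ᵐ y, y ∈ V → ENNReal.ofReal (M'.density u y) =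
      ENNReal.ofReal (|(fderiv ℝ ψ y).det| * M.density u (ψ y)) := by
  rw [← ae_restrict_iff' hV.measurableSet]
  have hψi : Set.InjOn ψ V := fun x hx y hy hxy =>
    M'.g_diffeo.injective (by rw [← hgψ x hx, ← hgψ y hy, hxy])
  have hdet : Measurable fun y => |(fderiv ℝ ψ y).det| :=
    (ContinuousLinearMap.continuous_det.measurable.comp (measurable_fderiv ℝ ψ)).abs
  have hp : AEMeasurable (fun y => M.density u (ψ y)) (volume.restrict V) :=
    (hcont.comp_continuousOn hψ.continuousOn).aemeasurable hV.measurableSet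
  refine ae_eq_of_forall_setLIntegral_eq_of_sigmaFinite₀
    (M'.density_measurable u).ennreal_ofReal.aemeasurable
    (hdet.aemeasurable.mul hp).ennreal_ofReal fun s hs _ => ?_
  rw [Measure.restrict_restrict hs]
  set S := s ∩ V
  have hS : MeasurableSet S := hs.inter hV.measurableSet
  have himg : M.g ⁻¹' (M'.g '' S) = ψ '' S := by
    ext x
    constructor
    · rintro ⟨y, hy, hxy⟩
      exact ⟨y, hy, M.g_diffeo.injective (by rw [hgψ y hy.2, hxy])⟩
    · rintro ⟨y, hy, rfl⟩
      exact ⟨y, hy, (hgψ y hy.2).symm⟩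
  have hderiv : ∀ y ∈ S, HasFDerivWithinAt ψ (fderiv ℝ ψ y) S y := fun y hy =>
    ((hψ.contDiffAt (hV.mem_nhds hy.2)).differentiableAt
      (by norm_num)).hasFDerivAt.hasFDerivWithinAt
  have hSimg : MeasurableSet (ψ '' S) := by
    rw [← himg]; exact M.measurable_g (M'.measurableSet_image_g hS)
  have key := h.latentLaw_eq_preimage_image u hS
  rw [himg, M.latentLaw_eq, M'.latentLaw_eq, withDensity_apply _ hS, withDensity_apply _ hSimg,
    lintegral_image_eq_lintegral_abs_det_fderiv_mul volume hS hderiv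
      (hψi.mono Set.inter_subset_right)] at key
  rw [key]
  simp only [ENNReal.ofReal_mul (abs_nonneg _)]

end CausalModel

theorem CoordCondIndep.exists_log_eq_add {n : ℕ} {μ : Measure (Fin n → ℝ)} [IsFiniteMeasure μ]
    {i j : Fin n} (hij : i ≠ j) (h : CoordCondIndep μ i j {i, j}ᶜ) {p q : (Fin n → ℝ) → ℝ}
    (hp : Measurable p) (hμ : μ = volume.withDensity fun z => ENNReal.ofReal (p z))
    {V : Set (Fin n → ℝ)} (hq : ∀ y ∈ V, 0 < q y)
    (hpq : ∀ᵐ y, y ∈ V → ENNReal.ofReal (p y) = ENNReal.ofReal (q y)) :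
    ∃ α β : (Fin n → ℝ) → ℝ, (∀ z t, α (Function.update z j t) = α z) ∧
      (∀ z t, β (Function.update z i t) = β z) ∧
      ∀ᵐ y, y ∈ V → Real.log (q y) = α y + β y := by
  subst hμ
  obtain ⟨a, b, ha, hb, hab⟩ := h.exists_factorization hij hp.ennreal_ofReal
  refine ⟨fun z => Real.log (a z).toReal, fun z => Real.log (b z).toReal,
    fun z t => by simp only [ha], fun z t => by simp only [hb], ?_⟩
  filter_upwards [hab, hpq] with y h1 h2 hy
  have hqy := hq y hy
  have h3 : (a y * b y).toReal = q y := by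
    rw [← h1, h2 hy, ENNReal.toReal_ofReal hqy.le]
  rw [ENNReal.toReal_mul] at h3
  rw [← h3]
  have : (a y).toReal * (b y).toReal ≠ 0 := by rw [h3]; exact hqy.ne'
  exact Real.log_mul (left_ne_zero_of_mul this) (right_ne_zero_of_mul this)

/-! ### Linear algebra and graph comparison. -/

theorem LinearIndependent.eq_zero_of_forall_sum_mul_eq_zero {ι κ : Type*} [Fintype ι] [Fintype κ]
    {v : κ → ι → ℝ} (hv : LinearIndependent ℝ v) (hcard : Fintype.card κ = Fintype.card ι)
    {c : ι → ℝ} (hc : ∀ k, ∑ x, v k x * c x = 0) : c = 0 := by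
  have hspan := hv.span_eq_top_of_card_eq_finrank' (by simpa using hcard)
  let T : (ι → ℝ) →ₗ[ℝ] ℝ := ∑ x, c x • LinearMap.proj x
  have hT : ∀ w, T w = ∑ x, w x * c x := fun w => by
    simp [T, LinearMap.sum_apply, mul_comm]
  have hT0 : T = 0 := by
    refine LinearMap.ext_on_range hspan fun k => ?_
    rw [hT, hc]; rfl
  ext x
  classical
  have := hT (Pi.single x 1)
  rw [hT0] at this
  simpa [Pi.single_apply] using this.symm

/-- Some term of the Leibniz expansion is nonzero. -/
theorem Matrix.exists_perm_forall_ne_zero {ι : Type*} [Fintype ι] [DecidableEq ι]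
    {J : Matrix ι ι ℝ} (hJ : J.det ≠ 0) : ∃ σ : Equiv.Perm ι, ∀ i, J (σ i) i ≠ 0 := by
  rw [Matrix.det_apply] at hJ
  obtain ⟨σ, -, hσ⟩ := Finset.exists_ne_zero_of_sum_ne_zero hJ
  refine ⟨σ, fun i hi => hσ ?_⟩
  have h0 : (∏ k, J (σ k) k) = 0 := Finset.prod_eq_zero (Finset.mem_univ i) hi
  rw [h0, smul_zero]

theorem SimpleGraph.nonempty_iso_of_ncard_le {V : Type*} [Finite V] {G H : SimpleGraph V}
    (σ : Equiv.Perm V) (hσ : ∀ i j, G.Adj (σ i) (σ j) → H.Adj i j)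
    (hcard : H.edgeSet.ncard ≤ G.edgeSet.ncard) : Nonempty (G ≃g H) := by
  have hle : G.comap σ ≤ H := fun i j => hσ i j
  let e : G.comap σ ≃g G := SimpleGraph.Iso.comap σ G
  have hc : (G.comap σ).edgeSet.ncard = G.edgeSet.ncard :=
    Nat.card_congr e.mapEdgeSet
  have heq : (G.comap σ).edgeSet = H.edgeSet :=
    Set.eq_of_subset_of_ncard_le (SimpleGraph.edgeSet_mono hle) (hc ▸ hcard) (Set.toFinite _)
  rw [SimpleGraph.edgeSet_inj] at heq
  exact ⟨heq ▸ e.symm⟩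

/-! ### Jacobian relations and the permutation. -/

namespace CausalModel

variable {n d m : ℕ} {M M' : CausalModel n d m}

theorem coordCondIndep_of_not_adj {i j : Fin n} (hij : i ≠ j) (h : ¬ M.markovNetwork.Adj i j)
    (u : Fin m) : CoordCondIndep (M.latentLaw u) i j {i, j}ᶜ := by
  have : ¬ (i ≠ j ∧ ¬ ∀ u, CoordCondIndep (M.latentLaw u) i j {i, j}ᶜ) := h
  tauto

theorem SmoothPositiveDensity.contDiff_logDensity (h : M.SmoothPositiveDensity) (u : Fin m) :
    ContDiff ℝ 2 (M.logDensity u) :=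
  (h u).1.log fun z => ((h u).2 z).ne'

theorem SmoothPositiveDensity.partialDeriv_partialDeriv_eq_zero (h : M.SmoothPositiveDensity)
    {i j : Fin n} (hij : i ≠ j) (hadj : ¬ M.markovNetwork.Adj i j) (u : Fin m) (z : Fin n → ℝ) :
    partialDeriv i (partialDeriv j (M.logDensity u)) z = 0 := by
  obtain ⟨α, β, hα, hβ, hae⟩ := (coordCondIndep_of_not_adj hij hadj u).exists_log_eq_add hij
    (M.density_measurable u) (M.latentLaw_eq u) (V := Set.univ) (fun y _ => (h u).2 y)
    (ae_of_all _ fun _ _ => rfl)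
  exact partialDeriv_partialDeriv_eq_zero_of_ae_eq_add isOpen_univ
    (h.contDiff_logDensity u).contDiffOn hα hβ hae (Set.mem_univ z)

theorem Matches.partialDeriv_partialDeriv_eq_zero (h : M.Matches M')
    (hA : M.SmoothPositiveDensity) {V : Set (Fin n → ℝ)} (hV : IsOpen V)
    {ψ : (Fin n → ℝ) → (Fin n → ℝ)} (hψ : ContDiffOn ℝ 2 ψ V)
    (hgψ : ∀ y ∈ V, M.g (ψ y) = M'.g y) (hinj : ∀ y ∈ V, Function.Injective (fderiv ℝ ψ y))
    {i j : Fin n} (hij : i ≠ j) (hadj : ¬ M'.markovNetwork.Adj i j) (u v : Fin m)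
    {y : Fin n → ℝ} (hy : y ∈ V) :
    partialDeriv i (partialDeriv j
      fun x => M.logDensity u (ψ x) - M.logDensity v (ψ x)) y = 0 := by
  have hdet : ∀ y ∈ V, |(fderiv ℝ ψ y).det| ≠ 0 := fun y hy => by
    have : IsUnit (fderiv ℝ ψ y).toLinearMap.det :=
      (LinearMap.isUnit_iff_isUnit_det _).1 ((LinearMap.isUnit_iff_ker_eq_bot _).2
        (LinearMap.ker_eq_bot.2 (hinj y hy)))
    exact abs_ne_zero.2 this.ne_zero
  have hsplit : ∀ u, ∃ α β : (Fin n → ℝ) → ℝ, (∀ z t, α (Function.update z j t) = α z) ∧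
      (∀ z t, β (Function.update z i t) = β z) ∧
      ∀ᵐ y, y ∈ V → Real.log (|(fderiv ℝ ψ y).det| * M.density u (ψ y)) = α y + β y := fun u =>
    (coordCondIndep_of_not_adj hij hadj u).exists_log_eq_add hij
      (M'.density_measurable u) (M'.latentLaw_eq u)
      (fun y hy => mul_pos (lt_of_le_of_ne (abs_nonneg _) (hdet y hy).symm) ((hA u).2 _))
      (h.density_eq_ae u hV (hA u).1.continuous hψ hgψ)
  obtain ⟨α, β, hα, hβ, hu⟩ := hsplit u
  obtain ⟨α', β', hα', hβ', hv⟩ := hsplit v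
  have hC : ∀ u, ContDiffOn ℝ 2 (fun x => M.logDensity u (ψ x)) V := fun u =>
    (hA.contDiff_logDensity u).comp_contDiffOn hψ
  refine partialDeriv_partialDeriv_eq_zero_of_ae_eq_add (α := fun x => α x - α' x)
    (β := fun x => β x - β' x) hV ((hC u).sub (hC v)) (fun z t => by rw [hα, hα'])
    (fun z t => by rw [hβ, hβ']) ?_ hy
  filter_upwards [hu, hv] with x hx hx' hxV
  have h1 := hx hxV
  have h2 := hx' hxV
  rw [Real.log_mul (hdet x hxV) ((hA _).2 _).ne'] at h1 h2
  simp only [logDensity]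
  linarith

open Classical in
theorem sum_sum_mul_eq_of_support_edges (H : Fin n → Fin n → ℝ) (hsymm : ∀ k l, H k l = H l k)
    (hzero : ∀ k l, k ≠ l → ¬ M.markovNetwork.Adj k l → H k l = 0) (a b : Fin n → ℝ) :
    ∑ l, ∑ k, H k l * (a k * b l) = ∑ k, H k k * (a k * b k) +
      ∑ e : M.OrderedEdge, H e.1.1 e.1.2 * (a e.1.1 * b e.1.2 + a e.1.2 * b e.1.1) := by
  have h1 : ∑ e : M.OrderedEdge, H e.1.1 e.1.2 * (a e.1.1 * b e.1.2 + a e.1.2 * b e.1.1) =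
      ∑ k, ∑ l, if k < l then H k l * (a k * b l + a l * b k) else 0 := by
    rw [← Finset.sum_subtype {e : Fin n × Fin n | e.1 < e.2 ∧ M.markovNetwork.Adj e.1 e.2}
      (by simp) (fun e => H e.1 e.2 * (a e.1 * b e.2 + a e.2 * b e.1)), Finset.sum_filter,
      Fintype.sum_prod_type]
    refine Finset.sum_congr rfl fun k _ => Finset.sum_congr rfl fun l _ => ?_
    by_cases hkl : k < l
    · by_cases hadj : M.markovNetwork.Adj k l
      · simp [hkl, hadj]
      · simp [hkl, hadj, hzero k l hkl.ne hadj]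
    · simp [hkl]
  have h2 : ∑ k, ∑ l, (if k < l then H k l * (a k * b l + a l * b k) else 0) =
      ∑ l, ∑ k, if k = l then 0 else H k l * (a k * b l) := by
    have h3 : ∑ k, ∑ l, (if k < l then H k l * (a l * b k) else 0) =
        ∑ l, ∑ k, if l < k then H k l * (a k * b l) else 0 :=
      Finset.sum_congr rfl fun k _ => Finset.sum_congr rfl fun l _ => by rw [hsymm]
    have h4 : ∑ k, ∑ l, (if k < l then H k l * (a k * b l) else 0) =
        ∑ l, ∑ k, if k < l then H k l * (a k * b l) else 0 := Finset.sum_comm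
    have h5 : ∑ k, ∑ l, (if k < l then H k l * (a k * b l + a l * b k) else 0) =
        ∑ k, ∑ l, (if k < l then H k l * (a k * b l) else 0) +
        ∑ k, ∑ l, (if k < l then H k l * (a l * b k) else 0) := by
      simp only [← Finset.sum_add_distrib]
      refine Finset.sum_congr rfl fun k _ => Finset.sum_congr rfl fun l _ => ?_
      split_ifs <;> ring
    rw [h5, h3, h4]
    simp only [← Finset.sum_add_distrib]
    refine Finset.sum_congr rfl fun l _ => Finset.sum_congr rfl fun k _ => ?_
    rcases lt_trichotomy k l with hkl | rfl | hkl
    · simp [hkl, hkl.ne, hkl.not_gt]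
    · simp
    · simp [hkl, hkl.ne', hkl.not_gt]
  rw [h1, h2, ← Finset.sum_add_distrib]
  refine Finset.sum_congr rfl fun l _ => ?_
  rw [← Finset.add_sum_erase _ _ (Finset.mem_univ l),
    ← Finset.add_sum_erase Finset.univ (fun k => if k = l then 0 else _) (Finset.mem_univ l)]
  simp only [if_true, zero_add]
  congr 1
  refine Finset.sum_congr rfl fun k hk => ?_
  rw [if_neg (Finset.ne_of_mem_erase hk)]

theorem card_orderedEdge_le [Fintype M.OrderedEdge] : Fintype.card M.OrderedEdge ≤ M.numEdges := by
  rw [← Nat.card_eq_fintype_card]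
  refine Nat.card_le_card_of_injective
    (fun e : M.OrderedEdge => (⟨s(e.1.1, e.1.2), e.2.2⟩ : M.markovNetwork.edgeSet)) ?_
  rintro ⟨⟨a, b⟩, hab, _⟩ ⟨⟨a', b'⟩, hab', _⟩ h
  have h' : s(a, b) = s(a', b') := congrArg Subtype.val h
  rw [Subtype.mk.injEq, Prod.mk.injEq]
  rcases Sym2.eq_iff.1 h' with h | ⟨rfl, rfl⟩
  · exact h
  · exact absurd hab (lt_asymm hab')

theorem matches_refl (M : CausalModel n d m) : M.Matches M := fun _ => rfl

/-- Under sufficient changes, a linear relation with constant coefficients that holds between the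
components of `w(z, u) - w(z, v)` for all domains is trivial. -/
theorem SufficientChanges.coeff_eq_zero (h : M.SufficientChanges) (z : Fin n → ℝ)
    [Fintype M.OrderedEdge] {c : Fin n ⊕ Fin n ⊕ M.OrderedEdge → ℝ}
    (hc : ∀ u v, ∑ x, (M.w z u x - M.w z v x) * c x = 0) : c = 0 := by
  obtain ⟨u, hu⟩ := h z
  refine hu.eq_zero_of_forall_sum_mul_eq_zero ?_ fun k => hc _ _
  -- Independence bounds the number of vectors by the dimension, so only one inequality between
  -- ordered pairs and edges is needed.
  refine le_antisymm ?_ ?_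
  · simpa using hu.fintype_card_le_finrank
  · have := card_orderedEdge_le (M := M)
    simp only [Fintype.card_sum, Fintype.card_fin]
    omega

theorem Matches.jacobian_relations (h : M.Matches M') (hA : M.SmoothPositiveDensity)
    (hA2 : M.SufficientChanges) {V : Set (Fin n → ℝ)} (hV : IsOpen V)
    {ψ : (Fin n → ℝ) → (Fin n → ℝ)} (hψ : ContDiffOn ℝ 2 ψ V)
    (hgψ : ∀ y ∈ V, M.g (ψ y) = M'.g y) (hinj : ∀ y ∈ V, Function.Injective (fderiv ℝ ψ y))
    {i j : Fin n} (hij : i ≠ j) (hadj : ¬ M'.markovNetwork.Adj i j)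
    {y : Fin n → ℝ} (hy : y ∈ V) :
    (∀ k, partialDeriv i (fun x => ψ x k) y * partialDeriv j (fun x => ψ x k) y = 0) ∧
    ∀ k l, M.markovNetwork.Adj k l →
      partialDeriv i (fun x => ψ x k) y * partialDeriv j (fun x => ψ x l) y +
        partialDeriv i (fun x => ψ x l) y * partialDeriv j (fun x => ψ x k) y = 0 := by
  classical
  have hψy : ContDiffAt ℝ 2 ψ y := hψ.contDiffAt (hV.mem_nhds hy)
  set a : Fin n → ℝ := fun k => partialDeriv i (fun x => ψ x k) y with ha
  set b : Fin n → ℝ := fun k => partialDeriv j (fun x => ψ x k) y with hb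
  have hc := hA2.coeff_eq_zero (ψ y) (c := Sum.elim
    (fun k => partialDeriv i (partialDeriv j fun x => ψ x k) y)
    (Sum.elim (fun k => a k * b k) fun e => a e.1.1 * b e.1.2 + a e.1.2 * b e.1.1)) fun u v => by
      have hL := fun u => hA.contDiff_logDensity u
      have h1 := h.partialDeriv_partialDeriv_eq_zero hA hV hψ hgψ hinj hij hadj u v hy
      have h2 := partialDeriv_partialDeriv_comp ((hL u).sub (hL v)) hψy i j
      have hd1 : ∀ l z, partialDeriv l (fun x => M.logDensity u x - M.logDensity v x) z =
          partialDeriv l (M.logDensity u) z - partialDeriv l (M.logDensity v) z := fun l z =>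
        partialDeriv_sub ((hL u).differentiable (by norm_num) z)
          ((hL v).differentiable (by norm_num) z) l
      have hd2 : ∀ k l z,
          partialDeriv k (partialDeriv l fun x => M.logDensity u x - M.logDensity v x) z =
          partialDeriv k (partialDeriv l (M.logDensity u)) z -
            partialDeriv k (partialDeriv l (M.logDensity v)) z := fun k l z => by
        rw [funext (hd1 l)]
        exact partialDeriv_sub ((hL u).contDiffAt.differentiableAt_partialDeriv l)
          ((hL v).contDiffAt.differentiableAt_partialDeriv l) k
      have h3 := h1.symm.trans h2
      simp only [hd1, hd2] at h3
      rw [sum_sum_mul_eq_of_support_edges (M := M) (fun k l =>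
          partialDeriv k (partialDeriv l (M.logDensity u)) (ψ y) -
            partialDeriv k (partialDeriv l (M.logDensity v)) (ψ y))
          (fun k l => by
            rw [partialDeriv_comm (hL u).contDiffAt, partialDeriv_comm (hL v).contDiffAt])
          (fun k l hkl hkl' => by
            rw [hA.partialDeriv_partialDeriv_eq_zero hkl hkl',
              hA.partialDeriv_partialDeriv_eq_zero hkl hkl', sub_zero]) a b] at h3
      simp only [Fintype.sum_sum_type, w, Sum.elim_inl, Sum.elim_inr]
      exact h3.symm
  refine ⟨fun k => congrFun hc (Sum.inr (Sum.inl k)), fun k l hkl => ?_⟩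
  rcases lt_or_gt_of_ne hkl.ne with hlt | hlt
  · exact congrFun hc (Sum.inr (Sum.inr ⟨(k, l), hlt, hkl⟩))
  · exact (add_comm _ _).trans (congrFun hc (Sum.inr (Sum.inr ⟨(l, k), hlt, hkl.symm⟩)))

theorem Matches.exists_perm_adj (h : M.Matches M') (hA : M.SmoothPositiveDensity)
    (hA2 : M.SufficientChanges) :
    ∃ σ : Equiv.Perm (Fin n),
      ∀ i j, M.markovNetwork.Adj (σ i) (σ j) → M'.markovNetwork.Adj i j := by
  -- This only supplies a domain: with none, matching would be vacuous.
  obtain ⟨u, -⟩ := hA2 0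
  obtain ⟨V, hV, ⟨y, hy⟩, hmaps⟩ := M.g_diffeo.exists_isOpen_mapsTo_range M'.g_diffeo
    (h.dense_preimage_range (u 0) (hA (u 0)).2)
  obtain ⟨ψ, hψ, hgψ, hinj⟩ := M.g_diffeo.exists_transition M'.g_diffeo hV hmaps
  have hψy : DifferentiableAt ℝ ψ y := (hψ.contDiffAt (hV.mem_nhds hy)).differentiableAt (by norm_num)
  let J : Matrix (Fin n) (Fin n) ℝ := LinearMap.toMatrix' (fderiv ℝ ψ y).toLinearMap
  have hJ : ∀ k i, J k i = partialDeriv i (fun x => ψ x k) y := fun k i => by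
    rw [partialDeriv, fderiv_apply hψy]
    simp only [J, LinearMap.toMatrix'_apply]
    rfl
  have hdet : J.det ≠ 0 := by
    rw [LinearMap.det_toMatrix']
    exact ((LinearMap.isUnit_iff_isUnit_det _).1 ((LinearMap.isUnit_iff_ker_eq_bot _).2
        (LinearMap.ker_eq_bot.2 (hinj y hy)))).ne_zero
  obtain ⟨σ, hσ⟩ := Matrix.exists_perm_forall_ne_zero hdet
  refine ⟨σ, fun i j hadj => ?_⟩
  by_contra hadj'
  have hij : i ≠ j := fun hij => hadj.ne (congrArg σ hij)
  obtain ⟨hdiag, hedge⟩ := h.jacobian_relations hA hA2 hV hψ hgψ hinj hij hadj' hy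
  have h1 := hdiag (σ i)
  have h2 := hedge _ _ hadj
  simp only [← hJ] at h1 h2
  have h3 := (mul_eq_zero.1 h1).resolve_left (hσ i)
  rw [h3, mul_zero, add_zero] at h2
  exact mul_ne_zero (hσ i) (hσ j) h2

end CausalModel

theorem mainTheorem1 {n d m : ℕ} (hnd : n ≤ d) (M M' : CausalModel n d m)
    (hA1 : M.SmoothPositiveDensity) (hA2 : M.SufficientChanges)
    (hM' : M.IsEdgeMinimalMatch M') :
    Nonempty (M.markovNetwork ≃g M'.markovNetwork) := by
  obtain ⟨σ, hσ⟩ := hM'.1.exists_perm_adj hA1 hA2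
  exact SimpleGraph.nonempty_iso_of_ncard_le σ hσ (hM'.2 M M.matches_refl)
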